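/- Consider $n \ge 1$ bins, all empty at the start, and the Caching process (also called memory protocol), which allocates exactly one ball per round. Let $x_i^t$ be the load of bin $i$ after $t$ rounds. The process keeps a cache, which is initially empty or holds an arbitrary fixed bin. In each round $t = 0, 1, 2, \ldots$ a bin $i$ is sampled uniformly at random, independently of the past. If the cache is empty, the ball is placed into $i$ and $i$ is stored in the cache. If the cache holds a bin $b$, then: - if $x_i^t < x_b^t$, the ball is placed into $i$ and the cache is updated to $i$; - if $x_i^t = x_b^t$, the ball is placed into $i$ and the cache keeps $b$; - if $x_i^t > x_b^t$, the ball is placed into $b$ and the cache keeps $b$. Let $\mathrm{Gap}(m) := \max_{i} x_i^m - \frac{1}{n}\sum_{i} x_i^m$ be the difference between the maximum and the average load after $m$ rounds. There is an absolute constant $C > 0$ such that for every number of bins $n \ge 1$, every such initial content of the cache, and every number of rounds $m \ge 1$, $$\Pr[\mathrm{Gap}(m) \le C \log n] \ge 1 - n^{-2}.$$ -/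

import Mathlib

/-- A state of the Caching (memory) process on `n` bins: the load of each bin, and the bin that is
stored in the cache (`none` if the cache is empty). -/
@[ext]
structure CachingState (n : ℕ) where
  load : Fin n → ℕ
  cache : Option (Fin n)

namespace CachingState

variable {n : ℕ}

/-- The load vector after one ball has been placed into bin `j`. -/
def addBall (x : Fin n → ℕ) (j : Fin n) : Fin n → ℕ :=
  Function.update x j (x j + 1)

/-- One round of Caching when `i` is the sampled bin. If the cache is empty, the ball goes to `i`
and `i` is cached. If the cache holds `b`, the ball goes to the less loaded of `i` and `b`, to `i`
in case of a tie, and the cache is updated to `i` exactly if `i` is strictly less loaded. -/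
def step (s : CachingState n) (i : Fin n) : CachingState n :=
  match s.cache with
  | none => ⟨addBall s.load i, some i⟩
  | some b =>
    if s.load i < s.load b then ⟨addBall s.load i, some i⟩
    else if s.load i = s.load b then ⟨addBall s.load i, some b⟩
    else ⟨addBall s.load b, some b⟩

/-- The total number of balls. -/
def totalLoad (s : CachingState n) : ℕ := ∑ i, s.load i

/-- The maximum load minus the average load. -/
noncomputable def gap (s : CachingState n) : ℝ :=
  ((Finset.univ.sup s.load : ℕ) : ℝ) - (s.totalLoad : ℝ) / (n : ℝ)

/-- Every set of states is an event. -/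
instance : MeasurableSpace (CachingState n) := ⊤

/-- The law of the state of Caching after `t` rounds, started from `n` empty bins with initial
cache content `c`; each round samples a fresh uniform bin. -/
noncomputable def law (n : ℕ) [NeZero n] (c : Option (Fin n)) : ℕ → PMF (CachingState n)
  | 0 => PMF.pure ⟨fun _ => 0, c⟩
  | t + 1 => (law n c t).bind fun s => (PMF.uniformOfFintype (Fin n)).map s.step

end CachingState

/-!
The cache makes every pair of consecutive rounds at least as good as a uniform ball followed by a
two-choice ball. If the two rounds sample `i` and `j`, the first ball lands no higher than `i` and
leaves in the cache a bin at most one above the old load of `i`, so the second ball lands at most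
one above the lower of `i` and `j`, whatever the cache held before
(`exists_step`, `expPotential_step_step_le`).

Write `y_k` for the load of bin `k` minus the average, and let `Γ = ∑ exp (θ y_k) + exp (-θ y_k)`.
A uniform ball leaves the expectation of `Γ` unchanged up to a term of order `θ² Γ / n`. The
two-choice ball decreases it further by `θ / n` times half the mean absolute difference,
`(1 / 2n) ∑_{i,j} (|a_i - a_j| + |1 / a_i - 1 / a_j|)` with `a_k = exp (θ y_k)`
(`two_mul_sub_minPotential`). As `∏ a_k = 1`, this is at least a constant fraction of
`Γ - O(n)`, and the fraction does not depend on `θ` (`sum_le_sum_dist`): some `a_j` serves as a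
pivot whose deviations are at most average, and if the pivot is far from `1` then so many `a_i`
must be far from it that the deviations pay for it (`le_dist_add_log`).

For a small absolute `θ` the gain beats the second order error, so the expectation of `Γ`
contracts over two rounds by a factor `1 - Ω(1 / n)` up to an additive constant
(`sum_hypPotential_step_step_le`). Hence it stays `O(n)` at all times, and Markov's inequality
bounds `exp (θ Gap) ≤ Γ` by a power of `n`.
-/

open Finset

namespace CachingState

variable {n : ℕ}

/-! ### Spread of positive numbers with geometric mean one -/

/-- Summed over numbers with product one, the logarithmic term vanishes, so a large pivot `z` is
paid for by the distances. The weight `z / log z` makes the inequality hold at `a = z`, where the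
distances vanish; for tiny `a` the negative logarithm is dominated by `a⁻¹`. -/
lemma le_dist_add_log {a z : ℝ} (ha : 0 < a) (hz : Real.exp 1 ≤ z) :
    z ≤ 2 * (|a - z| + |a⁻¹ - z⁻¹|) + z / Real.log z * Real.log a + 4 := by
  have hz2 : 2 ≤ z := by linarith [Real.exp_one_gt_d9]
  have hz0 : 0 < z := by linarith
  have hL : 1 ≤ Real.log z := (Real.le_log_iff_exp_le hz0).2 hz
  have hL0 : 0 < Real.log z := by linarith
  have hq : 0 < z / Real.log z := by positivity
  have hqL : z / Real.log z * Real.log z = z := by field_simp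
  have hqz : z / Real.log z ≤ z := div_le_self hz0.le hL
  have hzi : z⁻¹ ≤ 1 := inv_le_one_of_one_le₀ (by linarith)
  have h1 := abs_nonneg (a - z)
  have h2 := abs_nonneg (a⁻¹ - z⁻¹)
  have h3 := neg_abs_le (a - z)
  have h4 := le_abs_self (a⁻¹ - z⁻¹)
  rcases le_total z a with h | h
  · have := mul_le_mul_of_nonneg_left (Real.log_le_log hz0 h) hq.le
    linarith
  rcases le_total 1 a with h' | h'
  · have hla := mul_nonneg hq.le (Real.log_nonneg h')
    rcases le_total a (z / 2) with h5 | h5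
    · linarith
    · have hlog : Real.log z - Real.log a ≤ z / a - 1 := by
        rw [← Real.log_div hz0.ne' ha.ne']
        exact Real.log_le_sub_one_of_pos (by positivity)
      have h6 : z * (z / a - 1) ≤ 2 * (z - a) := by
        have : z * (z / a - 1) = z / a * (z - a) := by field_simp
        rw [this]
        exact mul_le_mul_of_nonneg_right ((div_le_iff₀ ha).2 (by linarith)) (by linarith)
      have h7 : z / Real.log z * (z / a - 1) ≤ z * (z / a - 1) :=
        mul_le_mul_of_nonneg_right hqz (by
          have : 1 ≤ z / a := (one_le_div ha).2 h
          linarith)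
      have h8 := mul_le_mul_of_nonneg_left hlog hq.le
      rw [mul_sub, hqL] at h8
      linarith
  · have hai : 1 ≤ a⁻¹ := (one_le_inv₀ ha).2 h'
    -- the logarithmic term is at most `max z a⁻¹` in absolute value
    have key : -(z / Real.log z * Real.log a) ≤ z ∨ -(z / Real.log z * Real.log a) ≤ a⁻¹ := by
      rcases le_total (-Real.log a) (Real.log z) with h5 | h5
      · left
        have := mul_le_mul_of_nonneg_left h5 hq.le
        linarith
      · right
        have hlog : -Real.log a - Real.log z ≤ a⁻¹ / z - 1 := by
          rw [← Real.log_inv, ← Real.log_div (by positivity) hz0.ne']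
          exact Real.log_le_sub_one_of_pos (by positivity)
        have h6 : 0 ≤ a⁻¹ / z - 1 := by linarith
        have h7 := mul_le_mul_of_nonneg_left hlog hq.le
        have h8 := mul_le_mul_of_nonneg_right hqz h6
        have h9 : z * (a⁻¹ / z - 1) = a⁻¹ - z := by field_simp
        rw [mul_sub, hqL] at h7
        linarith
    rcases key with h5 | h5 <;> linarith

/-- The deviation of the `a i` and of the `(a i)⁻¹` from one common pivot controls their sums. -/
lemma sum_le_of_pivot {ι : Type*} [Fintype ι] {a : ι → ℝ} (ha : ∀ i, 0 < a i)
    (hlog : ∑ i, Real.log (a i) = 0) {z : ℝ} (hz : 0 < z) :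
    ∑ i, (a i + (a i)⁻¹) ≤
      4 * ∑ i, (|a i - z| + |(a i)⁻¹ - z⁻¹|) + 5 * Fintype.card ι := by
  wlog h1 : 1 ≤ z generalizing a z
  · have := this (a := fun i => (a i)⁻¹) (fun i => inv_pos.2 (ha i))
      (by simp [Real.log_inv, hlog]) (inv_pos.2 hz) ((one_le_inv₀ hz).2 (le_of_not_ge h1))
    simpa only [inv_inv, add_comm] using this
  set D := ∑ i, (|a i - z| + |(a i)⁻¹ - z⁻¹|) with hD
  have hzD : Fintype.card ι * z ≤ 2 * D + 4 * Fintype.card ι := by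
    rcases le_total (Real.exp 1) z with h | h
    · have := sum_le_sum fun i (_ : i ∈ univ) => le_dist_add_log (ha i) h
      simp only [sum_add_distrib, ← mul_sum, hlog, sum_const, card_univ, nsmul_eq_mul,
        mul_zero, add_zero] at this
      rw [hD, sum_add_distrib]
      linarith
    · have hD0 : 0 ≤ D := sum_nonneg fun i _ => by positivity
      have : z ≤ 4 := h.trans (by linarith [Real.exp_one_lt_d9])
      nlinarith [Nat.cast_nonneg (α := ℝ) (Fintype.card ι)]
  have hpt : ∀ i, a i + (a i)⁻¹ ≤ (|a i - z| + |(a i)⁻¹ - z⁻¹|) + (z + 1) := fun i => by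
    have hzi : z⁻¹ ≤ 1 := inv_le_one_of_one_le₀ h1
    linarith [le_abs_self (a i - z), le_abs_self ((a i)⁻¹ - z⁻¹)]
  have hsum := sum_le_sum fun i (_ : i ∈ univ) => hpt i
  rw [sum_add_distrib (f := fun i => |a i - z| + |(a i)⁻¹ - z⁻¹|), ← hD, sum_const, card_univ,
    nsmul_eq_mul, mul_add, mul_one] at hsum
  have hD0 : 0 ≤ D := sum_nonneg fun i _ => by positivity
  linarith

/-- The pivot can be taken among the `a j` themselves, at the cost of averaging over `j`. -/
lemma sum_le_sum_dist {ι : Type*} [Fintype ι] [Nonempty ι] {a : ι → ℝ} (ha : ∀ i, 0 < a i)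
    (hlog : ∑ i, Real.log (a i) = 0) :
    ∑ i, (a i + (a i)⁻¹) ≤
      4 * ((∑ j, ∑ i, (|a i - a j| + |(a i)⁻¹ - (a j)⁻¹|)) / Fintype.card ι) +
        5 * Fintype.card ι := by
  obtain ⟨j, -, hj⟩ := exists_le_of_sum_le (s := univ)
    (f := fun j => ∑ i, (|a i - a j| + |(a i)⁻¹ - (a j)⁻¹|))
    (g := fun _ => (∑ j, ∑ i, (|a i - a j| + |(a i)⁻¹ - (a j)⁻¹|)) / Fintype.card ι)
    univ_nonempty (by
      rw [sum_const, card_univ, nsmul_eq_mul, mul_div_cancel₀]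
      exact_mod_cast Fintype.card_ne_zero)
  linarith [sum_le_of_pivot ha hlog (ha j)]

/-! ### The exponential potential -/

/-- The load of bin `k` relative to the average load. -/
noncomputable def height (s : CachingState n) (k : Fin n) : ℝ :=
  s.load k - s.totalLoad / n

/-- The exponential potential with parameter `θ`, which may be negative. -/
noncomputable def expPotential (θ : ℝ) (s : CachingState n) : ℝ :=
  ∑ k, Real.exp (θ * s.height k)

/-- The exponential potential seen by a ball that goes to the lower of two uniform bins. -/
noncomputable def minPotential (θ : ℝ) (s : CachingState n) : ℝ :=
  (∑ i, ∑ j, Real.exp (θ * min (s.height i) (s.height j))) / n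

lemma expPotential_nonneg (θ : ℝ) (s : CachingState n) : 0 ≤ expPotential θ s :=
  sum_nonneg fun _ _ => (Real.exp_pos _).le

lemma sum_height [NeZero n] (s : CachingState n) : ∑ k, s.height k = 0 := by
  have hn : (n : ℝ) ≠ 0 := NeZero.ne _
  simp only [height, sum_sub_distrib, sum_const, card_univ, Fintype.card_fin, nsmul_eq_mul,
    totalLoad]
  push_cast
  field_simp
  ring

lemma minPotential_nonneg (θ : ℝ) (s : CachingState n) : 0 ≤ minPotential θ s :=
  div_nonneg (sum_nonneg fun _ _ => sum_nonneg fun _ _ => (Real.exp_pos _).le) n.cast_nonneg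

lemma minPotential_le [NeZero n] (θ : ℝ) (s : CachingState n) :
    minPotential θ s ≤ 2 * expPotential θ s := by
  have hn : (0 : ℝ) < n := by exact_mod_cast NeZero.pos n
  rw [minPotential, div_le_iff₀ hn]
  calc ∑ i, ∑ j, Real.exp (θ * min (s.height i) (s.height j))
      ≤ ∑ i, ∑ j, (Real.exp (θ * s.height i) + Real.exp (θ * s.height j)) := by
        gcongr with i _ j _
        rcases min_choice (s.height i) (s.height j) with h | h <;> rw [h] <;>
          linarith [Real.exp_pos (θ * s.height i), Real.exp_pos (θ * s.height j)]
    _ = 2 * expPotential θ s * n := by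
        simp only [sum_add_distrib, sum_const, card_univ, Fintype.card_fin, nsmul_eq_mul,
          ← mul_sum, expPotential]
        ring

/-- What both potentials gain from the second choice is half the mean absolute difference. -/
lemma two_mul_sub_minPotential [NeZero n] {θ : ℝ} (hθ : 0 ≤ θ) (s : CachingState n) :
    2 * ((expPotential θ s - minPotential θ s) +
        (minPotential (-θ) s - expPotential (-θ) s)) =
      (∑ j, ∑ i, (|Real.exp (θ * s.height i) - Real.exp (θ * s.height j)| +
        |(Real.exp (θ * s.height i))⁻¹ - (Real.exp (θ * s.height j))⁻¹|)) / n := by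
  have hn : (n : ℝ) ≠ 0 := NeZero.ne _
  have hpt : ∀ i j, |Real.exp (θ * s.height i) - Real.exp (θ * s.height j)| +
        |(Real.exp (θ * s.height i))⁻¹ - (Real.exp (θ * s.height j))⁻¹| =
      Real.exp (θ * s.height i) + Real.exp (θ * s.height j)
        - 2 * Real.exp (θ * min (s.height i) (s.height j))
        + 2 * Real.exp (-θ * min (s.height i) (s.height j))
        - Real.exp (-θ * s.height i) - Real.exp (-θ * s.height j) := by
    intro i j
    simp only [← Real.exp_neg, neg_mul]
    rcases le_total (s.height i) (s.height j) with h | h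
    · have h' := mul_le_mul_of_nonneg_left h hθ
      rw [min_eq_left h, abs_of_nonpos (by simpa using h'), abs_of_nonneg (by simpa using h')]
      ring
    · have h' := mul_le_mul_of_nonneg_left h hθ
      rw [min_eq_right h, abs_of_nonneg (by simpa using h'), abs_of_nonpos (by simpa using h')]
      ring
  simp only [hpt, sum_add_distrib, sum_sub_distrib, sum_const, card_univ, Fintype.card_fin,
    nsmul_eq_mul, ← mul_sum]
  rw [sum_comm (f := fun j i => Real.exp (θ * min (s.height i) (s.height j))),
    sum_comm (f := fun j i => Real.exp (-θ * min (s.height i) (s.height j)))]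
  simp only [expPotential, minPotential]
  field_simp
  ring

/-- The sum of the exponential potentials of parameters `θ` and `-θ`. -/
noncomputable def hypPotential (θ : ℝ) (s : CachingState n) : ℝ :=
  expPotential θ s + expPotential (-θ) s

lemma hypPotential_nonneg (θ : ℝ) (s : CachingState n) : 0 ≤ hypPotential θ s :=
  add_nonneg (expPotential_nonneg _ _) (expPotential_nonneg _ _)

lemma hypPotential_le_gain [NeZero n] {θ : ℝ} (hθ : 0 ≤ θ) (s : CachingState n) :
    hypPotential θ s ≤ 8 * ((expPotential θ s - minPotential θ s) +
        (minPotential (-θ) s - expPotential (-θ) s)) + 5 * n := by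
  have h := sum_le_sum_dist (a := fun i => Real.exp (θ * s.height i))
    (fun i => Real.exp_pos _) (by simp only [Real.log_exp, ← mul_sum, sum_height, mul_zero])
  rw [Fintype.card_fin, ← two_mul_sub_minPotential hθ s] at h
  have : ∑ i, (Real.exp (θ * s.height i) + (Real.exp (θ * s.height i))⁻¹) =
      hypPotential θ s := by
    simp only [← Real.exp_neg, ← neg_mul, sum_add_distrib, hypPotential, expPotential]
  linarith

/-! ### Drift over two rounds -/

/-- The ball never lands above the sampled bin or the cached bin, and the bin that is cached
afterwards is at most one above the sampled bin. -/
lemma exists_step (s : CachingState n) (i : Fin n) :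
    ∃ k b, (s.step i).load = addBall s.load k ∧ (s.step i).cache = some b ∧
      s.load k ≤ s.load i ∧ (∀ c, s.cache = some c → s.load k ≤ s.load c) ∧
      (s.step i).load b ≤ s.load i + 1 := by
  obtain ⟨x, _ | c⟩ := s
  · exact ⟨i, i, by simp [step, addBall]⟩
  · rcases lt_trichotomy (x i) (x c) with h | h | h
    · exact ⟨i, i, by simp [step, addBall, h, h.le]⟩
    · refine ⟨i, c, ?_⟩
      simp only [step, h, addBall, lt_irrefl, if_true, if_false, Function.update_apply]
      split_ifs <;> simp
    · exact ⟨c, c, by simp [step, addBall, h.not_gt, h.ne', h.le]⟩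

lemma addBall_le (x : Fin n → ℕ) (k j : Fin n) : addBall x k j ≤ x j + 1 := by
  rw [addBall, Function.update_apply]
  split_ifs with h
  · rw [h]
  · omega

lemma totalLoad_eq_of_addBall {s t : CachingState n} {k : Fin n}
    (h : t.load = addBall s.load k) : t.totalLoad = s.totalLoad + 1 := by
  simp only [totalLoad, h, addBall, sum_update_of_mem (mem_univ k), sdiff_singleton_eq_erase]
  rw [← add_sum_erase _ s.load (mem_univ k)]
  ring

lemma expPotential_of_addBall [NeZero n] (θ : ℝ) {s t : CachingState n} {k : Fin n}
    (h : t.load = addBall s.load k) :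
    expPotential θ t = Real.exp (-θ / n) *
      (expPotential θ s + (Real.exp θ - 1) * Real.exp (θ * s.height k)) := by
  have hn : (n : ℝ) ≠ 0 := NeZero.ne _
  have hpt : ∀ j, Real.exp (θ * t.height j) = Real.exp (-θ / n) *
      (Real.exp (θ * s.height j) +
        if j = k then (Real.exp θ - 1) * Real.exp (θ * s.height k) else 0) := by
    intro j
    simp only [height, totalLoad_eq_of_addBall h, h, addBall, Function.update_apply]
    split_ifs with hj
    · subst hj
      rw [sub_one_mul, add_sub_cancel, ← Real.exp_add, ← Real.exp_add]
      congr 1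
      push_cast
      field_simp
      ring
    · rw [add_zero, ← Real.exp_add]
      congr 1
      push_cast
      field_simp
      ring
  simp only [expPotential, hpt, ← mul_sum, sum_add_distrib, sum_ite_eq', mem_univ, if_true]

/-- For either sign of `θ`, the change caused by a ball grows with the height it lands at. -/
lemma exp_sub_one_mul_exp_le {θ u v : ℝ} (h : u ≤ v) :
    (Real.exp θ - 1) * Real.exp (θ * u) ≤ (Real.exp θ - 1) * Real.exp (θ * v) := by
  rcases le_total 0 θ with hθ | hθ
  · have h1 : 0 ≤ Real.exp θ - 1 := sub_nonneg.2 (Real.one_le_exp hθ)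
    gcongr
  · have h1 : Real.exp θ - 1 ≤ 0 := sub_nonpos.2 (Real.exp_le_one_iff.2 hθ)
    exact mul_le_mul_of_nonpos_left
      (Real.exp_le_exp.2 (mul_le_mul_of_nonpos_left h hθ)) h1

/-- Two rounds are at least as balanced as one uniform ball followed by a ball at height at most
one above the lower of two uniform bins. -/
lemma expPotential_step_step_le [NeZero n] (θ : ℝ) (s : CachingState n) (i j : Fin n) :
    expPotential θ ((s.step i).step j) ≤ Real.exp (-2 * θ / n) *
      (expPotential θ s + (Real.exp θ - 1) * Real.exp (θ * s.height i) +
        (Real.exp θ - 1) * Real.exp θ * Real.exp (θ * min (s.height i) (s.height j))) := by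
  obtain ⟨k, b, hk, hb, hki, -, hbi⟩ := exists_step s i
  obtain ⟨l, -, hl, -, hlj, hlb, -⟩ := exists_step (s.step i) j
  have hn : (0 : ℝ) < n := by exact_mod_cast NeZero.pos n
  have h1 : s.height k ≤ s.height i := by
    simp only [height]
    gcongr
  have hli : (s.step i).load l ≤ s.load i + 1 := (hlb b hb).trans hbi
  have hlj' : (s.step i).load l ≤ s.load j + 1 := hlj.trans (by rw [hk]; exact addBall_le _ _ _)
  have h2 : (s.step i).height l ≤ min (s.height i) (s.height j) + (1 - 1 / n) := by
    rw [← min_add_add_right]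
    have h3 : ((s.step i).load l : ℝ) ≤ s.load i + 1 := by exact_mod_cast hli
    have h4 : ((s.step i).load l : ℝ) ≤ s.load j + 1 := by exact_mod_cast hlj'
    apply le_min <;> simp only [height, totalLoad_eq_of_addBall hk] <;> push_cast <;>
      rw [add_div] <;> linarith
  rw [expPotential_of_addBall θ hl, expPotential_of_addBall θ hk]
  calc _ ≤ Real.exp (-θ / n) * (Real.exp (-θ / n) *
        (expPotential θ s + (Real.exp θ - 1) * Real.exp (θ * s.height i)) +
        (Real.exp θ - 1) *
          Real.exp (θ * (min (s.height i) (s.height j) + (1 - 1 / n)))) := by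
        gcongr _ * (_ * (_ + ?_) + ?_)
        · exact exp_sub_one_mul_exp_le h1
        · exact exp_sub_one_mul_exp_le h2
    _ = _ := by
        have e1 : Real.exp (-2 * θ / n) = Real.exp (-θ / n) * Real.exp (-θ / n) := by
          rw [← Real.exp_add]; congr 1; ring
        have e2 : Real.exp (θ * (min (s.height i) (s.height j) + (1 - 1 / n))) =
            Real.exp (-θ / n) * (Real.exp θ *
              Real.exp (θ * min (s.height i) (s.height j))) := by
          rw [← Real.exp_add, ← Real.exp_add]; congr 1; ring
        rw [e1, e2]
        ring

/-- Second order expansion, uniform in both signs of `θ`; here `h` stands for `1 / n`. -/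
lemma two_round_expansion {θ h P M : ℝ} (hθ : |θ| ≤ 1 / 10) (h0 : 0 ≤ h) (h1 : h ≤ 1)
    (hP : 0 ≤ P) (hM : 0 ≤ M) (hMP : M ≤ 2 * P) :
    Real.exp (-2 * θ * h) * (P + (Real.exp θ - 1) * h * P +
        (Real.exp θ - 1) * Real.exp θ * h * M) ≤
      P + θ * h * (M - P) + 16 * θ ^ 2 * h * P := by
  obtain ⟨hl, hu⟩ := abs_le.1 hθ
  have hsq : θ ^ 2 ≤ 1 / 100 := by nlinarith
  have hexp : ∀ x : ℝ, |x| ≤ 1 → Real.exp x ≤ 1 + x + x ^ 2 := fun x hx => by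
    linarith [(abs_le.1 (Real.abs_exp_sub_one_sub_id_le hx)).2]
  have ha : |θ * h| ≤ 1 / 10 := by
    rw [abs_mul, abs_of_nonneg h0]
    nlinarith [abs_nonneg θ]
  obtain ⟨hal, hau⟩ := abs_le.1 ha
  have e1 : Real.exp θ - 1 ≤ θ + θ ^ 2 := by
    linarith [hexp θ (by linarith)]
  have e2 : (Real.exp θ - 1) * Real.exp θ ≤ θ + 4 * θ ^ 2 := by
    have h3 := hexp (2 * θ) (by rw [abs_mul, abs_two]; linarith)
    have h4 := Real.add_one_le_exp θ
    have h5 : Real.exp (2 * θ) = Real.exp θ * Real.exp θ := by rw [← Real.exp_add]; ring_nf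
    nlinarith
  have e3 : Real.exp (-2 * θ * h) ≤ 1 - 2 * (θ * h) + 4 * (θ * h) ^ 2 := by
    have h3 := hexp (-2 * θ * h) (by rw [abs_le]; constructor <;> linarith)
    linarith
  set B := P + h * ((θ + θ ^ 2) * P) + h * ((θ + 4 * θ ^ 2) * M) with hB
  have hB0 : 0 ≤ B := by
    have h3 : -(1 / 10) * P ≤ (θ + θ ^ 2) * P :=
      mul_le_mul_of_nonneg_right (by nlinarith) hP
    have h4 : -(1 / 10) * M ≤ (θ + 4 * θ ^ 2) * M :=
      mul_le_mul_of_nonneg_right (by nlinarith) hM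
    have h5 : h * (-(3 / 10) * P) ≤ h * ((θ + θ ^ 2) * P + (θ + 4 * θ ^ 2) * M) :=
      mul_le_mul_of_nonneg_left (by linarith) h0
    nlinarith
  have hEB : P + (Real.exp θ - 1) * h * P + (Real.exp θ - 1) * Real.exp θ * h * M ≤ B := by
    have h3 := mul_le_mul_of_nonneg_right e1 (mul_nonneg h0 hP)
    have h4 := mul_le_mul_of_nonneg_right e2 (mul_nonneg h0 hM)
    rw [hB]
    nlinarith
  have key : 4 * h * P + (-2 + 4 * (θ * h)) * (h * (P + M)) +
      (1 - 2 * (θ * h) + 4 * (θ * h) ^ 2) * (P + 4 * M) ≤ 16 * P := by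
    have h3 : (-2 + 4 * (θ * h)) * (h * (P + M)) ≤ 0 :=
      mul_nonpos_of_nonpos_of_nonneg (by linarith) (by positivity)
    have h4 : (1 - 2 * (θ * h) + 4 * (θ * h) ^ 2) * (P + 4 * M) ≤ 5 / 4 * (P + 4 * M) :=
      mul_le_mul_of_nonneg_right (by nlinarith) (by positivity)
    have h5 : h * P ≤ 1 * P := mul_le_mul_of_nonneg_right h1 hP
    linarith
  calc _ ≤ Real.exp (-2 * θ * h) * B := mul_le_mul_of_nonneg_left hEB (Real.exp_pos _).le
    _ ≤ (1 - 2 * (θ * h) + 4 * (θ * h) ^ 2) * B := mul_le_mul_of_nonneg_right e3 hB0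
    _ = P + θ * h * (M - P) + θ ^ 2 * h * (4 * h * P + (-2 + 4 * (θ * h)) * (h * (P + M)) +
        (1 - 2 * (θ * h) + 4 * (θ * h) ^ 2) * (P + 4 * M)) := by rw [hB]; ring
    _ ≤ P + θ * h * (M - P) + θ ^ 2 * h * (16 * P) := by gcongr
    _ = _ := by ring

lemma sum_expPotential_step_step_le [NeZero n] {θ : ℝ} (hθ : |θ| ≤ 1 / 10)
    (s : CachingState n) :
    (∑ i, (∑ j, expPotential θ ((s.step i).step j)) / n) / n ≤
      expPotential θ s + θ / n * (minPotential θ s - expPotential θ s) +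
        16 * θ ^ 2 / n * expPotential θ s := by
  have hn : (n : ℝ) ≠ 0 := NeZero.ne _
  have hn1 : (1 : ℝ) ≤ n := by exact_mod_cast NeZero.pos n
  have h := two_round_expansion (h := 1 / (n : ℝ)) hθ (by positivity)
    ((div_le_one (by positivity)).2 hn1) (expPotential_nonneg θ s)
    (minPotential_nonneg θ s) (minPotential_le θ s)
  calc _ ≤ (∑ i, (∑ j, Real.exp (-2 * θ / n) *
      (expPotential θ s + (Real.exp θ - 1) * Real.exp (θ * s.height i) +
        (Real.exp θ - 1) * Real.exp θ *
          Real.exp (θ * min (s.height i) (s.height j)))) / n) / n := by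
        gcongr with i _ j _
        exact expPotential_step_step_le θ s i j
    _ = Real.exp (-2 * θ * (1 / n)) * (expPotential θ s +
          (Real.exp θ - 1) * (1 / n) * expPotential θ s +
          (Real.exp θ - 1) * Real.exp θ * (1 / n) * minPotential θ s) := by
        rw [← sum_div]
        simp only [← mul_sum, sum_add_distrib, sum_const, card_univ, Fintype.card_fin,
          nsmul_eq_mul]
        rw [minPotential, mul_one_div]
        simp only [expPotential]
        field_simp
    _ ≤ _ := h
    _ = _ := by ring

/-- Drift inequality. The parameter is small enough for the second order error, `16 θ²`, to be
half of the gain `θ / 8`. -/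
lemma sum_hypPotential_step_step_le [NeZero n] (s : CachingState n) :
    (∑ i, (∑ j, hypPotential (1 / 256) ((s.step i).step j)) / n) / n ≤
      (1 - 1 / (4096 * n)) * hypPotential (1 / 256) s + 10 / 4096 := by
  have hn : (0 : ℝ) < n := by exact_mod_cast NeZero.pos n
  have h1 := sum_expPotential_step_step_le (θ := 1 / 256) (by norm_num [abs_of_pos]) s
  have h2 := sum_expPotential_step_step_le (θ := -(1 / 256)) (by norm_num [abs_of_pos]) s
  have h3 := hypPotential_le_gain (θ := 1 / 256) (by norm_num) s
  have h4 : 1 / 256 / n * (hypPotential (1 / 256) s / 8 - 5 / 8 * n) ≤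
      1 / 256 / n * ((expPotential (1 / 256) s - minPotential (1 / 256) s) +
        (minPotential (-(1 / 256)) s - expPotential (-(1 / 256)) s)) :=
    mul_le_mul_of_nonneg_left (by linarith) (by positivity)
  have h5 : 1 / 256 / n * (hypPotential (1 / 256) s / 8 - 5 / 8 * n) =
      2 / (4096 * n) * hypPotential (1 / 256) s - 10 / 4096 := by
    field_simp
    ring
  have h6 : (∑ i, (∑ j, hypPotential (1 / 256) ((s.step i).step j)) / n) / n =
      (∑ i, (∑ j, expPotential (1 / 256) ((s.step i).step j)) / n) / n +
      (∑ i, (∑ j, expPotential (-(1 / 256)) ((s.step i).step j)) / n) / n := by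
    simp only [hypPotential, sum_add_distrib, add_div]
  rw [h5] at h4
  rw [h6]
  have h7 : 1 / 256 / (n : ℝ) * ((expPotential (1 / 256) s - minPotential (1 / 256) s) +
        (minPotential (-(1 / 256)) s - expPotential (-(1 / 256)) s)) =
      -(1 / 256 / n * (minPotential (1 / 256) s - expPotential (1 / 256) s) +
        -(1 / 256) / n * (minPotential (-(1 / 256)) s - expPotential (-(1 / 256)) s)) := by
    ring
  have h8 : 16 * (1 / 256) ^ 2 / (n : ℝ) * expPotential (1 / 256) s +
      16 * (-(1 / 256)) ^ 2 / n * expPotential (-(1 / 256)) s =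
      1 / (4096 * n) * hypPotential (1 / 256) s := by
    rw [hypPotential]
    field_simp
    ring
  have h9 : (1 - 1 / (4096 * n)) * hypPotential (1 / 256) s = hypPotential (1 / 256) s
      - 2 / (4096 * n) * hypPotential (1 / 256) s +
      1 / (4096 * n) * hypPotential (1 / 256) s := by ring
  rw [h9]
  have h10 : hypPotential (1 / 256) s =
    expPotential (1 / 256) s + expPotential (-(1 / 256)) s := rfl
  linarith

/-! ### Expectations under the law of the process -/

open scoped ENNReal

/-- The expectation of `f` after `t` rounds. -/
noncomputable def expect [NeZero n] (c : Option (Fin n)) (t : ℕ)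
    (f : CachingState n → ℝ≥0∞) : ℝ≥0∞ :=
  ∑' s, law n c t s * f s

lemma expect_zero [NeZero n] (c : Option (Fin n)) (f : CachingState n → ℝ≥0∞) :
    expect c 0 f = f ⟨fun _ => 0, c⟩ := by
  classical
  rw [expect, tsum_eq_single ⟨fun _ => 0, c⟩]
  · simp [law]
  · intro s hs
    simp [law, hs]

lemma expect_succ [NeZero n] (c : Option (Fin n)) (t : ℕ) (f : CachingState n → ℝ≥0∞) :
    expect c (t + 1) f = expect c t fun s => (∑ i, f (s.step i)) / n := by
  classical
  simp only [expect, law, PMF.bind_apply, ← ENNReal.tsum_mul_right]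
  rw [ENNReal.tsum_comm]
  refine tsum_congr fun s => ?_
  simp only [mul_assoc, ENNReal.tsum_mul_left]
  congr 1
  simp only [PMF.map_apply, PMF.uniformOfFintype_apply, tsum_fintype, sum_mul]
  rw [Summable.tsum_finsetSum fun _ _ => ENNReal.summable, div_eq_mul_inv, sum_mul]
  refine sum_congr rfl fun i _ => ?_
  rw [tsum_eq_single (s.step i)]
  · simp [mul_comm]
  · intro u hu
    simp [hu]

lemma expect_mono [NeZero n] (c : Option (Fin n)) (t : ℕ) {f g : CachingState n → ℝ≥0∞}
    (h : ∀ s, f s ≤ g s) : expect c t f ≤ expect c t g :=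
  ENNReal.tsum_le_tsum fun s => mul_le_mul_right (h s) _

lemma expect_mul_add [NeZero n] (c : Option (Fin n)) (t : ℕ) (f : CachingState n → ℝ≥0∞)
    (a b : ℝ≥0∞) : (expect c t fun s => a * f s + b) = a * expect c t f + b := by
  simp only [expect, mul_add, mul_left_comm _ a, ENNReal.tsum_add, ENNReal.tsum_mul_left,
    ENNReal.tsum_mul_right, PMF.tsum_coe, one_mul]

lemma ofReal_sum_div [NeZero n] {f : Fin n → ℝ} (hf : ∀ i, 0 ≤ f i) :
    (∑ i, ENNReal.ofReal (f i)) / n = ENNReal.ofReal ((∑ i, f i) / n) := by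
  have hn : (0 : ℝ) < n := by exact_mod_cast NeZero.pos n
  rw [ENNReal.ofReal_div_of_pos hn, ENNReal.ofReal_sum_of_nonneg fun i _ => hf i,
    ENNReal.ofReal_natCast]

lemma hypPotential_init [NeZero n] (θ : ℝ) (c : Option (Fin n)) :
    hypPotential θ (⟨fun _ => 0, c⟩ : CachingState n) = 2 * n := by
  simp [hypPotential, expPotential, height, totalLoad]
  ring

lemma height_step_init [NeZero n] (c : Option (Fin n)) (i k : Fin n) :
    |((⟨fun _ => 0, c⟩ : CachingState n).step i).height k| ≤ 1 := by
  have hn : (1 : ℝ) ≤ n := by exact_mod_cast NeZero.pos n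
  obtain ⟨l, -, hl, -⟩ := exists_step (⟨fun _ => 0, c⟩ : CachingState n) i
  have h1 := addBall_le (fun _ => 0) l k
  have h2 : (addBall (fun _ => 0) l k : ℝ) ≤ 1 := by exact_mod_cast h1
  have h3 : (0 : ℝ) ≤ addBall (fun _ => 0) l k := Nat.cast_nonneg _
  have h4 : 1 / (n : ℝ) ≤ 1 := (div_le_one (by linarith)).2 hn
  have h5 : 0 ≤ 1 / (n : ℝ) := by positivity
  rw [height, totalLoad_eq_of_addBall hl, hl]
  simp only [totalLoad, sum_const_zero, zero_add, Nat.cast_one]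
  rw [abs_le]
  constructor <;> linarith

lemma hypPotential_step_init_le [NeZero n] (c : Option (Fin n)) (i : Fin n) :
    hypPotential (1 / 256) ((⟨fun _ => 0, c⟩ : CachingState n).step i) ≤ 10 * n := by
  have h : ∀ x : ℝ, x ≤ 1 → Real.exp x ≤ 5 := fun x hx =>
    (Real.exp_le_exp.2 hx).trans (by linarith [Real.exp_one_lt_d9])
  have hk := fun k => abs_le.1 (height_step_init c i k)
  have h1 : ∀ θ : ℝ, |θ| ≤ 1 →
      expPotential θ ((⟨fun _ => 0, c⟩ : CachingState n).step i) ≤ 5 * n := by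
    intro θ hθ
    calc _ ≤ ∑ _k : Fin n, (5 : ℝ) := by
          refine sum_le_sum fun k _ => h _ ((le_abs_self _).trans ?_)
          rw [abs_mul]
          exact mul_le_one₀ hθ (abs_nonneg _) (height_step_init c i k)
      _ = 5 * n := by simp [mul_comm]
  have := h1 (1 / 256) (by norm_num [abs_of_pos])
  have := h1 (-(1 / 256)) (by norm_num [abs_of_pos])
  rw [hypPotential]
  linarith

/-- The expected potential stays linear in `n`: `10 n` is the fixed point of the drift inequality,
and the two possible starting times `0` and `1` lie below it. -/
lemma expect_hypPotential_le [NeZero n] (c : Option (Fin n)) (t : ℕ) :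
    (expect c t fun s => ENNReal.ofReal (hypPotential (1 / 256) s)) ≤
      ENNReal.ofReal (10 * n) := by
  have hn : (1 : ℝ) ≤ n := by exact_mod_cast NeZero.pos n
  induction t using Nat.twoStepInduction with
  | zero =>
    rw [expect_zero, hypPotential_init]
    exact ENNReal.ofReal_le_ofReal (by linarith)
  | one =>
    rw [expect_succ, expect_zero, ofReal_sum_div fun i => hypPotential_nonneg _ _]
    refine ENNReal.ofReal_le_ofReal ((div_le_iff₀ (by linarith)).2 ?_)
    refine (sum_le_sum fun i _ => hypPotential_step_init_le c i).trans_eq ?_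
    simp [mul_comm]
  | more t ih _ =>
    have hα : (0 : ℝ) ≤ 1 - 1 / (4096 * n) := by
      have : 1 / (4096 * (n : ℝ)) ≤ 1 := (div_le_one (by positivity)).2 (by linarith)
      linarith
    calc _ = expect c t fun s => ENNReal.ofReal
          ((∑ i, (∑ j, hypPotential (1 / 256) ((s.step i).step j)) / n) / n) := by
          rw [expect_succ, expect_succ]
          congr 1
          funext s
          rw [← ofReal_sum_div fun i => div_nonneg
            (sum_nonneg fun j _ => hypPotential_nonneg _ _) n.cast_nonneg]
          congr 1
          exact sum_congr rfl fun i _ => ofReal_sum_div fun j => hypPotential_nonneg _ _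
      _ ≤ expect c t fun s => ENNReal.ofReal (1 - 1 / (4096 * n)) *
          ENNReal.ofReal (hypPotential (1 / 256) s) + ENNReal.ofReal (10 / 4096) := by
          refine expect_mono c t fun s => ?_
          rw [← ENNReal.ofReal_mul hα, ← ENNReal.ofReal_add
            (mul_nonneg hα (hypPotential_nonneg _ _)) (by norm_num)]
          exact ENNReal.ofReal_le_ofReal (sum_hypPotential_step_step_le s)
      _ ≤ ENNReal.ofReal (1 - 1 / (4096 * n)) * ENNReal.ofReal (10 * n) +
          ENNReal.ofReal (10 / 4096) := by
          rw [expect_mul_add]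
          gcongr
      _ = ENNReal.ofReal (10 * n) := by
          rw [← ENNReal.ofReal_mul hα, ← ENNReal.ofReal_add
            (mul_nonneg hα (by positivity)) (by norm_num)]
          congr 1
          field_simp
          ring

lemma exp_gap_le [NeZero n] (s : CachingState n) {θ : ℝ} :
    Real.exp (θ * s.gap) ≤ hypPotential θ s := by
  obtain ⟨k, -, hk⟩ := exists_mem_eq_sup univ univ_nonempty s.load
  have : s.gap = s.height k := by rw [gap, hk, height]
  rw [this]
  refine (single_le_sum (f := fun k => Real.exp (θ * s.height k))
    (fun _ _ => (Real.exp_pos _).le) (mem_univ k)).trans ?_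
  exact le_add_of_nonneg_right (expPotential_nonneg _ _)

/-- Markov's inequality. -/
lemma toMeasure_le_expect_div [NeZero n] (c : Option (Fin n)) (t : ℕ)
    {f : CachingState n → ℝ≥0∞} {a : ℝ≥0∞} (ha : a ≠ 0) (ha' : a ≠ ∞)
    {S : Set (CachingState n)} (hS : ∀ s ∈ S, a ≤ f s) :
    (law n c t).toMeasure S ≤ expect c t f / a := by
  rw [ENNReal.le_div_iff_mul_le (Or.inl ha) (Or.inl ha'), PMF.toMeasure_apply _ (s := S) trivial,
    ← ENNReal.tsum_mul_right]
  refine ENNReal.tsum_le_tsum fun s => ?_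
  by_cases h : s ∈ S
  · rw [Set.indicator_of_mem h]
    exact mul_le_mul_right (hS s h) _
  · simp [h]

end CachingState

theorem lemma4p6 :
    ∃ C : ℝ, 0 < C ∧ ∀ (n : ℕ) [NeZero n] (c : Option (Fin n)) (m : ℕ), 1 ≤ m →
      1 - ((n : ℝ) ^ 2)⁻¹ ≤
        (CachingState.law n c m).toMeasure.real {s | s.gap ≤ C * Real.log n} := by
  -- `256` undoes the parameter of the potential. In the exponent `7 = 1 + 2 + 4`, the expected
  -- potential `10 n` takes `1`, the failure probability `2`, and `10 ≤ 2 ^ 4 ≤ n ^ 4` the rest.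
  refine ⟨256 * 7, by norm_num, fun n _ c m _ => ?_⟩
  obtain rfl | hn := (Nat.one_le_iff_ne_zero.2 (NeZero.ne n)).eq_or_lt'
  · simp
  have hn2 : (2 : ℝ) ≤ n := by exact_mod_cast hn
  have hn0 : (0 : ℝ) < n := by linarith
  set S := {s : CachingState n | s.gap ≤ 256 * 7 * Real.log n} with hS
  have hbad : (CachingState.law n c m).toMeasure Sᶜ ≤ ENNReal.ofReal (((n : ℝ) ^ 2)⁻¹) := by
    refine (CachingState.toMeasure_le_expect_div c m
      (f := fun s => ENNReal.ofReal (CachingState.hypPotential (1 / 256) s))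
      (a := ENNReal.ofReal ((n : ℝ) ^ 7)) ?_ ENNReal.ofReal_ne_top ?_).trans ?_
    · simpa using by positivity
    · intro s hs
      have hs' : 256 * 7 * Real.log n < s.gap := not_le.1 hs
      refine ENNReal.ofReal_le_ofReal (le_trans ?_ s.exp_gap_le)
      rw [← Real.log_le_iff_le_exp (by positivity), Real.log_pow]
      push_cast
      linarith
    · refine (ENNReal.div_le_div_right (CachingState.expect_hypPotential_le c m) _).trans ?_
      rw [← ENNReal.ofReal_div_of_pos (by positivity)]
      refine ENNReal.ofReal_le_ofReal ?_
      rw [div_le_iff₀ (by positivity)]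
      have h4 : (2 : ℝ) ^ 4 ≤ (n : ℝ) ^ 4 := by gcongr
      have h5 : ((n : ℝ) ^ 2)⁻¹ * (n : ℝ) ^ 7 = (n : ℝ) ^ 4 * n := by field_simp
      rw [h5]
      gcongr
      linarith
  have : MeasureTheory.IsProbabilityMeasure (CachingState.law n c m).toMeasure := inferInstance
  have hcompl := MeasureTheory.probReal_compl_eq_one_sub
    (μ := (CachingState.law n c m).toMeasure) (s := S) trivial
  have hreal : (CachingState.law n c m).toMeasure.real Sᶜ ≤ ((n : ℝ) ^ 2)⁻¹ :=
    ENNReal.toReal_le_of_le_ofReal (by positivity) hbad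
  linarith
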